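/- Let $k$ be a positive integer and $q$ a prime power. The Waring number $g(k,q)$ is the maximal number of summands needed to express an element of the finite field $\mathbb{F}_q$ with $q$ elements as a sum of $k$-th powers of elements of $\mathbb{F}_q$, i.e. the maximum over all $a\in\mathbb{F}_q$ of the least $n$ such that $a=x_1^k+\dots+x_n^k$ for some $x_1,\dots,x_n\in\mathbb{F}_q$ (with $g(k,q)=\infty$ if some element is not a sum of $k$-th powers). Theorem. Let $p$ and $r$ be odd primes such that $p$ is a primitive root modulo $r$. Then $$ g\left(\frac{p^{r-1}-1}{2r},\,p^{r-1}\right)= \begin{cases} \left\lfloor \frac{pr}{4}-\frac{p}{4r}\right\rfloor & \text{if } r<p,\\[2pt] \left\lfloor \frac{pr}{4}-\frac{r}{4p}\right\rfloor & \text{if } r\ge p. \end{cases} $$ In particular, the Waring number is finite in this case. -/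

import Mathlib

/-- `a` is a sum of `n` many `k`-th powers of elements of `F`. -/
def IsSumOfPowers {F : Type*} [Field F] (k n : ℕ) (a : F) : Prop :=
  ∃ x : Fin n → F, a = ∑ i, x i ^ k

/-- The number of summands needed to express `a` as a sum of `k`-th powers of elements of `F`
(`⊤` if `a` is not a sum of `k`-th powers). -/
noncomputable def powerLength {F : Type*} [Field F] (k : ℕ) (a : F) : ℕ∞ :=
  ⨅ (n : ℕ) (_ : IsSumOfPowers k n a), (n : ℕ∞)

/-- The Waring number `g(k, q)` of a field `F` with `q` elements: the maximal number of summands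
needed to express an element of `F` as a sum of `k`-th powers
(`⊤` if some element is not a sum of `k`-th powers). -/
noncomputable def waringNumber (k : ℕ) (F : Type*) [Field F] : ℕ∞ :=
  ⨆ a : F, powerLength k a

/-! Write `p = 2h+1`, `r = 2s+1`. The nonzero `k`-th powers are the `2r`-th roots of unity `±ζ^i`.
Since `p` is a primitive root mod `r`, the only linear relation among `1, ζ, ..., ζ^(r-1)` over
`ZMod p`, up to scalars, is that their sum vanishes. So `F` is `(ZMod p)^r` modulo constant vectors,
and the length of the class of `a` is the minimum over `c` of `∑ i, leeWeight (a i - c)`. The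
theorem computes the maximum of this minimum over placements `a` of `r` points on a circle of `p`
places.

Upper bounds come from averaging over all `c` (`exists_sum_leeWeight_le`), or over the points `c = a
j` only (`exists_sum_leeWeight_le'`). They are sharp: `exists_almost_constant` prescribes nearly
equal distance sums, and `exists_le_sum_leeWeight` (`r > p`) and `exists_le_sum_leeWeight'` (`r <
p`) build points realizing them. -/

open Finset

/-! ### Lee weights on a cycle of odd length. -/

/-- The Lee weight of a residue class: the least absolute value of its representatives. -/
def leeWeight {n : ℕ} (x : ZMod n) : ℕ := x.valMinAbs.natAbs

lemma leeWeight_natCast {n a : ℕ} [NeZero n] (ha : a ≤ n) :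
    leeWeight (a : ZMod n) = min a (n - a) := by
  rw [leeWeight, ZMod.valMinAbs_natAbs_eq_min, ZMod.val_natCast]
  rcases ha.lt_or_eq with h | rfl
  · rw [Nat.mod_eq_of_lt h]
  · simp

lemma leeWeight_neg {n : ℕ} (x : ZMod n) : leeWeight (-x) = leeWeight x :=
  ZMod.natAbs_valMinAbs_neg x

lemma leeWeight_eq_of_intCast {n : ℕ} [NeZero n] {x : ZMod n} {y : ℤ} (hx : x = (y : ZMod n))
    (h0 : 0 ≤ y) (hy : 2 * y ≤ n) : (leeWeight x : ℤ) = y := by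
  lift y to ℕ using h0
  rw [hx, Int.cast_natCast, leeWeight_natCast (by omega)]
  omega

/-- The points `y ± h` are almost antipodal to `y`, so pairing each with `y` gives weights `h` and
`h + 1`, except that both pairs give `h` at `y = 0`. The identity inverts convolution with the Lee
weight, up to constants. -/
lemma leeWeight_add_half (h : ℕ) (y : ZMod (2 * h + 1)) :
    leeWeight (y + (h : ZMod (2 * h + 1))) + 2 * leeWeight y +
      leeWeight (y - (h : ZMod (2 * h + 1))) + (if y = 0 then 1 else 0)
      = 2 * h + 1 := by
  obtain ⟨v, hv, rfl⟩ : ∃ v : ℕ, v < 2 * h + 1 ∧ (v : ZMod (2 * h + 1)) = y :=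
    ⟨y.val, y.val_lt, ZMod.natCast_zmod_val y⟩
  have hp : (2 * h + 1 : ZMod (2 * h + 1)) = 0 := by
    exact_mod_cast ZMod.natCast_self (2 * h + 1)
  have hif : (if (v : ZMod (2 * h + 1)) = 0 then 1 else 0) = if v = 0 then 1 else 0 := by
    congr 1
    rw [ZMod.natCast_eq_zero_iff]
    exact propext ⟨fun hd => Nat.eq_zero_of_dvd_of_lt hd hv, fun h0 => h0 ▸ dvd_zero _⟩
  rw [hif]
  rcases le_or_gt v h with hvh | hvh
  · have h1 : (v + h : ZMod (2 * h + 1)) = ((v + h : ℕ) : ZMod (2 * h + 1)) := by push_cast; ring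
    have h2 : (v - h : ZMod (2 * h + 1)) = ((v + h + 1 : ℕ) : ZMod (2 * h + 1)) := by
      push_cast; linear_combination -hp
    rw [h1, h2, leeWeight_natCast (by omega), leeWeight_natCast (by omega),
      leeWeight_natCast (by omega)]
    split_ifs <;> omega
  · have h1 : (v + h : ZMod (2 * h + 1)) = ((v - (h + 1) : ℕ) : ZMod (2 * h + 1)) := by
      rw [Nat.cast_sub (by omega)]; push_cast; linear_combination hp
    have h2 : (v - h : ZMod (2 * h + 1)) = ((v - h : ℕ) : ZMod (2 * h + 1)) := by
      rw [Nat.cast_sub (by omega)]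
    rw [h1, h2, leeWeight_natCast (by omega), leeWeight_natCast (by omega),
      leeWeight_natCast (by omega)]
    split_ifs <;> omega

lemma sum_leeWeight (h : ℕ) : ∑ x : ZMod (2 * h + 1), leeWeight x = h * (h + 1) := by
  have key := Finset.sum_congr (rfl : (univ : Finset (ZMod (2 * h + 1))) = univ)
    (fun y _ => leeWeight_add_half h y)
  simp only [sum_add_distrib, ← mul_sum, sum_ite_eq', mem_univ, if_true, sum_const, card_univ,
    ZMod.card, smul_eq_mul] at key
  have h1 : ∑ x : ZMod (2 * h + 1), leeWeight (x + (h : ZMod (2 * h + 1))) = ∑ x, leeWeight x :=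
    Equiv.sum_comp (Equiv.addRight (h : ZMod (2 * h + 1))) leeWeight
  have h2 : ∑ x : ZMod (2 * h + 1), leeWeight (x - (h : ZMod (2 * h + 1))) = ∑ x, leeWeight x :=
    Equiv.sum_comp (Equiv.subRight (h : ZMod (2 * h + 1))) leeWeight
  rw [h1, h2] at key
  nlinarith

/-! ### Upper bounds by averaging. -/

lemma exists_mul_le_of_sum_le {α : Type*} [Fintype α] [Nonempty α] {f : α → ℕ} {N : ℕ}
    (hf : ∑ x, f x ≤ N) : ∃ x, f x ≤ N / Fintype.card α := by
  by_contra! hlt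
  have h1 : ∑ _x : α, (N / Fintype.card α + 1) ≤ ∑ x, f x := sum_le_sum fun x _ => hlt x
  rw [sum_const, card_univ, smul_eq_mul] at h1
  have := Nat.lt_mul_div_succ N (Fintype.card_pos (α := α))
  omega

/-- Averaging over all translations. -/
lemma exists_sum_leeWeight_le {ι : Type*} [Fintype ι] (h : ℕ) (a : ι → ZMod (2 * h + 1)) :
    ∃ c, ∑ i, leeWeight (a i - c) ≤ Fintype.card ι * (h * (h + 1)) / (2 * h + 1) := by
  have := exists_mul_le_of_sum_le (f := fun c => ∑ i, leeWeight (a i - c))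
    (N := Fintype.card ι * (h * (h + 1))) (by
      rw [sum_comm]
      refine (sum_le_card_nsmul univ _ (h * (h + 1)) fun i _ => ?_).trans_eq (by simp)
      exact ((Equiv.sum_comp (Equiv.subLeft (a i)) leeWeight).trans (sum_leeWeight h)).le)
  simpa [ZMod.card] using this

/-- The Lee weight of `d` is at most the number of translates of a half circle that contain `0`
but not `d`. -/
lemma leeWeight_le_card_half (h : ℕ) (d : ZMod (2 * h + 1)) :
    leeWeight d ≤ #{t : ZMod (2 * h + 1) | t.val ≤ h ∧ h < (t + d).val} := by
  obtain ⟨v, hv, rfl⟩ : ∃ v : ℕ, v < 2 * h + 1 ∧ (v : ZMod (2 * h + 1)) = d :=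
    ⟨d.val, d.val_lt, ZMod.natCast_zmod_val d⟩
  rw [leeWeight_natCast hv.le]
  have key : ∀ t : ℕ → ℕ, (∀ j < min v (2 * h + 1 - v), t j ≤ h ∧ h < t j + v ∧
      t j + v < 2 * h + 1) → Set.InjOn t (range (min v (2 * h + 1 - v))) →
      min v (2 * h + 1 - v) ≤
        #{t : ZMod (2 * h + 1) | t.val ≤ h ∧ h < (t + v).val} := by
    intro t ht hinj
    conv_lhs => rw [← card_range (min v (2 * h + 1 - v))]
    refine card_le_card_of_injOn (fun j => (t j : ZMod (2 * h + 1))) ?_ ?_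
    · intro j hj
      obtain ⟨h1, h2, h3⟩ := ht j (by simpa using hj)
      simp only [coe_filter, mem_univ, true_and, Set.mem_ofPred_eq]
      rw [← Nat.cast_add, ZMod.val_natCast_of_lt h3, ZMod.val_natCast_of_lt (by omega)]
      exact ⟨h1, h2⟩
    · intro i hi j hj hij
      obtain ⟨h1, h2, h3⟩ := ht i (by simpa using hi)
      obtain ⟨h1', h2', h3'⟩ := ht j (by simpa using hj)
      refine hinj hi hj ?_
      have := congrArg ZMod.val hij
      rwa [ZMod.val_natCast_of_lt (by omega), ZMod.val_natCast_of_lt (by omega)] at this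
  -- Shifting by `v` pushes `h, h - 1, ...` out of the half circle `{0, ..., h}` if `v ≤ h`, and `0,
  -- 1, ...` otherwise, without wrapping around.
  rcases le_or_gt v h with hvh | hvh
  · refine key (fun j => h - j) (fun j hj => by omega) ?_
    intro i hi j hj hij
    simp only [coe_range, Set.mem_Iio] at hi hj hij
    omega
  · exact key (fun j => j) (fun j hj => by omega) (Set.injOn_id _)

/-- Averaging over the points themselves. -/
lemma exists_sum_leeWeight_le' {ι : Type*} [Fintype ι] (h s : ℕ) (hι : Fintype.card ι = 2 * s + 1)
    (a : ι → ZMod (2 * h + 1)) :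
    ∃ c, ∑ i, leeWeight (a i - c) ≤ (2 * h + 1) * (s * (s + 1)) / (2 * s + 1) := by
  have : Nonempty ι := Fintype.card_pos_iff.mp (by omega)
  suffices hN : ∑ j, ∑ i, leeWeight (a i - a j) ≤ (2 * h + 1) * (s * (s + 1)) by
    obtain ⟨j, hj⟩ := exists_mul_le_of_sum_le hN
    exact ⟨a j, hι ▸ hj⟩
  have h1 : ∀ i j, leeWeight (a i - a j) ≤ ∑ t : ZMod (2 * h + 1),
      (if (t + a j).val ≤ h then 1 else 0) * (if h < (t + a i).val then 1 else 0) := by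
    intro i j
    refine (leeWeight_le_card_half h _).trans (le_of_eq ?_)
    rw [card_filter, ← Equiv.sum_comp (Equiv.addRight (a j))]
    refine sum_congr rfl fun t _ => ?_
    have : t + a j + (a i - a j) = t + a i := by ring
    simp only [Equiv.coe_addRight, this, ite_and, ite_mul, one_mul, zero_mul]
  calc ∑ j, ∑ i, leeWeight (a i - a j)
      ≤ ∑ j, ∑ i, ∑ t : ZMod (2 * h + 1),
        (if (t + a j).val ≤ h then 1 else 0) * (if h < (t + a i).val then 1 else 0) :=
        sum_le_sum fun j _ => sum_le_sum fun i _ => h1 i j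
    _ = ∑ t : ZMod (2 * h + 1), (∑ j, if (t + a j).val ≤ h then 1 else 0) *
        (∑ i, if h < (t + a i).val then 1 else 0) := by
        simp only [sum_mul_sum]
        rw [sum_comm]
        conv_lhs => enter [2, i]; rw [sum_comm]
        rw [sum_comm]
        exact sum_congr rfl fun t _ => sum_comm
    _ ≤ ∑ _t : ZMod (2 * h + 1), s * (s + 1) := by
        -- A half circle splits the `2s+1` points into `x` inside and `y` outside; `x * y` is
        -- largest for the split `s`, `s + 1`.
        refine sum_le_sum fun t _ => ?_
        have hsum : (∑ j, if (t + a j).val ≤ h then 1 else 0) +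
            (∑ i, if h < (t + a i).val then 1 else 0) = 2 * s + 1 := by
          rw [← sum_add_distrib, ← hι, ← card_univ, card_eq_sum_ones]
          refine sum_congr rfl fun i _ => ?_
          split_ifs <;> omega
        generalize (∑ j, if (t + a j).val ≤ h then 1 else 0) = x at hsum ⊢
        generalize (∑ j, if h < (t + a j).val then 1 else 0) = y at hsum ⊢
        rcases le_or_gt x s with hx | hx
        · obtain ⟨z, rfl⟩ := Nat.exists_eq_add_of_le hx
          obtain rfl : y = x + 2 * z + 1 := by omega
          nlinarith
        · obtain ⟨z, rfl⟩ := Nat.exists_eq_add_of_lt hx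
          obtain rfl : s = y + z := by omega
          nlinarith
    _ = _ := by simp [ZMod.card]

/-! ### Lower bounds: extremal configurations. -/

/-- An almost constant function on a cycle of odd length with prescribed sum, whose larger values
are kept apart as far as possible. -/
lemma exists_almost_constant (s v : ℕ) (hv : Odd v) (huv : 2 * s + 1 < v) :
    ∃ E : ZMod (2 * s + 1) → ℕ, (∀ k, v * (s * (s + 1)) / (2 * s + 1) ≤ E k) ∧
      (∀ k, 2 * (E k + E (k + 1)) ≤ (2 * s + 1) * v) ∧ ∑ k, E k = v * (s * (s + 1)) := by
  obtain ⟨w, rfl⟩ := hv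
  set N := (2 * w + 1) * (s * (s + 1)) with hN
  set m := N / (2 * s + 1) with hm
  set ρ := N % (2 * s + 1) with hρ
  have hρlt : ρ < 2 * s + 1 := Nat.mod_lt _ (by omega)
  have hdiv : (2 * s + 1) * m + ρ = N := Nat.div_add_mod _ _
  have hsum : ∀ e : ℕ → ℕ, ∑ k ∈ range (2 * s + 1), e k = ρ →
      ∑ k : ZMod (2 * s + 1), (m + e k.val) = N := by
    intro e he
    rw [sum_add_distrib, sum_const, card_univ, ZMod.card, smul_eq_mul, ← hdiv, ← he]
    congr 1
    exact Fin.sum_univ_eq_sum_range e (2 * s + 1)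
  have hval : ∀ k : ZMod (2 * s + 1), (k + 1).val = k.val + 1 ∨ (k + 1).val = 0 := by
    intro k
    rw [ZMod.val_add, ZMod.val_one_eq_one_mod, Nat.add_mod_mod]
    rcases (Nat.succ_le_of_lt k.val_lt).lt_or_eq with hk | hk
    · exact Or.inl (Nat.mod_eq_of_lt hk)
    · exact Or.inr (by rw [Nat.succ_eq_add_one] at hk; rw [hk, Nat.mod_self])
  -- This is `4s(s+1) = (2s+1)^2 - 1` multiplied by `v = 2w+1`; with `2s+1 < v` it bounds `m` in
  -- both cases below.
  have hkey : (2 * s + 1) * ((2 * s + 1) * (2 * w + 1)) =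
      (2 * s + 1) * (4 * m) + (2 * w + 1 + 4 * ρ) := by
    nlinarith
  have hodd : (2 * s + 1) * (2 * w + 1) = 2 * (2 * s * w + s + w) + 1 := by ring
  rcases le_or_gt ρ s with hs | hs
  -- The `ρ ≤ s` larger values sit at `1, 3, ..., 2ρ - 1`, no two adjacent even cyclically, so
  -- neighbours sum to at most `2m + 1`.
  · refine ⟨fun k => m + if k.val % 2 = 1 ∧ k.val < 2 * ρ then 1 else 0, fun k => by simp,
      fun k => ?_, hsum (fun j => if j % 2 = 1 ∧ j < 2 * ρ then 1 else 0) ?_⟩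
    · have hM : 4 * m + 1 < (2 * s + 1) * (2 * w + 1) := by
        by_contra! hcon
        nlinarith [Nat.mul_le_mul_left (2 * s + 1) hcon]
      clear_value m ρ
      generalize (2 * s + 1) * (2 * w + 1) = X at hM hodd ⊢
      rcases hval k with h1 | h1 <;> dsimp only <;> rw [h1] <;> split_ifs <;>
        first | omega | tauto
    · have : ∀ n, ∑ k ∈ range n, (if k % 2 = 1 ∧ k < 2 * ρ then 1 else 0) = min (n / 2) ρ := by
        intro n
        induction n with
        | zero => simp
        | succ n ih => rw [sum_range_succ, ih]; split_ifs <;> omega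
      rw [this]; omega
  -- Here `v + 4ρ > 3(2s+1)`, which leaves room for adjacent larger values, so any placement works.
  · refine ⟨fun k => m + if k.val < ρ then 1 else 0, fun k => by simp,
      fun k => ?_, hsum (fun j => if j < ρ then 1 else 0) ?_⟩
    · have hM : 4 * m + 4 ≤ (2 * s + 1) * (2 * w + 1) := by
        by_contra! hcon
        nlinarith [Nat.mul_le_mul_left (2 * s + 1) (Nat.lt_succ_iff.mp hcon)]
      clear_value m ρ
      generalize (2 * s + 1) * (2 * w + 1) = X at hM hodd ⊢
      dsimp only
      split_ifs <;> omega
    · have : ∀ n, ∑ k ∈ range n, (if k < ρ then 1 else 0) = min n ρ := by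
        intro n
        induction n with
        | zero => simp
        | succ n ih => rw [sum_range_succ, ih]; split_ifs <;> omega
      rw [this]; omega

lemma exists_fun_with_multiplicities {ι β M : Type*} [Fintype ι] [Fintype β] [AddCommMonoid M]
    (n : β → ℕ) (hn : ∑ x, n x = Fintype.card ι) :
    ∃ a : ι → β, ∀ g : β → M, ∑ i, g (a i) = ∑ x, n x • g x := by
  obtain ⟨e⟩ : Nonempty (ι ≃ Σ x, Fin (n x)) := by
    rw [← Fintype.card_eq]; simp [hn]
  refine ⟨fun i => (e i).1, fun g => ?_⟩
  rw [Equiv.sum_comp e (fun y => g y.1), Fintype.sum_sigma]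
  simp

/-- More points than places on the circle. -/
lemma exists_le_sum_leeWeight {ι : Type*} [Fintype ι] (h : ℕ) (hodd : Odd (Fintype.card ι))
    (hlt : 2 * h + 1 < Fintype.card ι) :
    ∃ a : ι → ZMod (2 * h + 1), ∀ c,
      Fintype.card ι * (h * (h + 1)) / (2 * h + 1) ≤ ∑ i, leeWeight (a i - c) := by
  obtain ⟨E, hE1, hE2, hE3⟩ := exists_almost_constant h _ hodd hlt
  set r := Fintype.card ι
  have hp : (2 * h + 1 : ZMod (2 * h + 1)) = 0 := by
    exact_mod_cast ZMod.natCast_self (2 * h + 1)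
  set H : ZMod (2 * h + 1) := (h : ZMod (2 * h + 1)) with hH
  -- As `-2 * H = 1`, this turns steps of `H` into steps of `1`, so `hE2` controls `f` at `x` and `x
  -- ± H`.
  let φ : ZMod (2 * h + 1) ≃ ZMod (2 * h + 1) :=
    { toFun := fun x => -2 * x
      invFun := fun x => H * x
      left_inv := fun x => by linear_combination -x * hp
      right_inv := fun x => by linear_combination -x * hp }
  set f : ZMod (2 * h + 1) → ℕ := fun x => E (φ x) with hf
  have hfsum : ∑ x, f x = r * (h * (h + 1)) := by rw [← hE3]; exact Equiv.sum_comp φ E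
  have hfle : ∀ x, f (x + H) + 2 * f x + f (x - H) ≤ (2 * h + 1) * r := by
    intro x
    have h1 : φ (x + H) = φ x + 1 := by
      change -2 * (x + H) = -2 * x + 1; linear_combination -hp
    have h2 : φ x = φ (x - H) + 1 := by
      change -2 * x = -2 * (x - H) + 1; linear_combination -hp
    have h3 := hE2 (φ x)
    have h4 := hE2 (φ (x - H))
    rw [← h1] at h3
    rw [← h2] at h4
    simp only [hf]
    omega
  -- By `leeWeight_add_half`, multiplicities `n` equal to this slack have Lee distance sum exactly
  -- `f c` at every `c`; `t1` and `t2` below verify it.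
  choose n hn using fun x => Nat.exists_eq_add_of_le' (hfle x)
  have hadd : ∑ x, f (x + H) = ∑ x, f x := Equiv.sum_comp (Equiv.addRight H) f
  have hsub : ∑ x, f (x - H) = ∑ x, f x := Equiv.sum_comp (Equiv.subRight H) f
  have hnsum : ∑ x, n x = r := by
    have := Finset.sum_congr (rfl : (univ : Finset (ZMod (2 * h + 1))) = univ) (fun x _ => hn x)
    simp only [sum_add_distrib, ← mul_sum, hadd, hsub, hfsum, sum_const, card_univ, ZMod.card,
      smul_eq_mul] at this
    nlinarith
  obtain ⟨a, ha⟩ := exists_fun_with_multiplicities (ι := ι) (M := ℕ) n hnsum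
  refine ⟨a, fun c => ?_⟩
  rw [ha fun x => leeWeight (x - c)]
  have e1 : ∑ x, f (x + H) * leeWeight (x - c) = ∑ x, f x * leeWeight (x - c - H) := by
    rw [← Equiv.sum_comp (Equiv.addRight H) (fun x => f x * leeWeight (x - c - H))]
    refine sum_congr rfl fun x _ => ?_
    simp only [Equiv.coe_addRight]
    congr 2; ring
  have e2 : ∑ x, f (x - H) * leeWeight (x - c) = ∑ x, f x * leeWeight (x - c + H) := by
    rw [← Equiv.sum_comp (Equiv.subRight H) (fun x => f x * leeWeight (x - c + H))]
    refine sum_congr rfl fun x _ => ?_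
    simp only [Equiv.subRight_apply]
    congr 2; ring
  have e3 : ∑ x, leeWeight (x - c) = h * (h + 1) :=
    (Equiv.sum_comp (Equiv.subRight c) leeWeight).trans (sum_leeWeight h)
  have t1 : ∑ x, n x * leeWeight (x - c) + ∑ x, f x * (leeWeight (x - c + H) +
      2 * leeWeight (x - c) + leeWeight (x - c - H)) = (2 * h + 1) * r * (h * (h + 1)) := by
    have : ∀ x, (2 * h + 1) * r * leeWeight (x - c) = n x * leeWeight (x - c) +
        (f (x + H) * leeWeight (x - c) + 2 * (f x * leeWeight (x - c)) +
          f (x - H) * leeWeight (x - c)) := fun x => by rw [hn x]; ring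
    rw [← e3, mul_sum, sum_congr rfl fun x _ => this x]
    simp only [mul_add, sum_add_distrib, e1, e2, ← mul_sum, mul_left_comm _ 2]
    ring
  have t2 : ∑ x, f x * (leeWeight (x - c + H) +
      2 * leeWeight (x - c) + leeWeight (x - c - H)) + f c = (2 * h + 1) * ∑ x, f x := by
    rw [mul_sum]
    have : f c = ∑ x, f x * (if x - c = 0 then 1 else 0) := by
      simp [sub_eq_zero]
    rw [this, ← sum_add_distrib]
    refine sum_congr rfl fun x _ => ?_
    rw [← mul_add, leeWeight_add_half, mul_comm]
  rw [hfsum] at t2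
  have t3 := hE1 (φ c)
  change _ ≤ f c at t3
  simp only [smul_eq_mul]
  nlinarith

/-- The sum of Lee distances is concave between consecutive points, so that its minimum is attained
at one of them. -/
lemma le_sum_leeWeight_of_forall {ι : Type*} [Fintype ι] [Nonempty ι] {n m : ℕ} [NeZero n]
    (a : ι → ZMod n) (ha : ∀ j, m ≤ ∑ i, leeWeight (a i - a j)) (c : ZMod n) :
    m ≤ ∑ i, leeWeight (a i - c) := by
  -- The nearest points behind and ahead of `c`, at distances `t` and `u`. No point lies strictly
  -- between them, so on this arc the Lee distance to each point is concave, which is `key`.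
  obtain ⟨i₀, -, h0⟩ := exists_min_image univ (fun i => (c - a i).val) univ_nonempty
  obtain ⟨i₁, -, h1⟩ := exists_min_image univ (fun i => (a i - c).val) univ_nonempty
  simp only [mem_univ, true_implies] at h0 h1
  have e0 : a i₀ = c - ((c - a i₀).val : ZMod n) := by rw [ZMod.natCast_zmod_val]; ring
  have e1 : a i₁ = c + ((a i₁ - c).val : ZMod n) := by rw [ZMod.natCast_zmod_val]; ring
  generalize (c - a i₀).val = t at h0 e0
  generalize (a i₁ - c).val = u at h1 e1
  rcases Nat.eq_zero_or_pos (t + u) with htu | htu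
  · obtain rfl : t = 0 := by omega
    have := ha i₀
    rwa [e0, Nat.cast_zero, sub_zero] at this
  have key : ∀ i, u * leeWeight (a i - a i₀) + t * leeWeight (a i - a i₁) ≤
      (t + u) * leeWeight (a i - c) := by
    intro i
    have hu := h1 i
    have ht := h0 i
    set w := (a i - c).val with hw
    have hwlt : w < n := ZMod.val_lt _
    have hcast : (w : ZMod n) = a i - c := ZMod.natCast_zmod_val _
    have hwt : w + t ≤ n := by
      rw [← neg_sub, ZMod.neg_val] at ht
      split_ifs at ht <;> omega
    have f0 : a i - a i₀ = ((w + t : ℕ) : ZMod n) := by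
      rw [e0, Nat.cast_add, hcast]; ring
    have f1 : a i - a i₁ = ((w - u : ℕ) : ZMod n) := by
      rw [e1, Nat.cast_sub hu, hcast]; ring
    rw [f0, f1, ← hcast, leeWeight_natCast hwt, leeWeight_natCast (by omega),
      leeWeight_natCast hwlt.le]
    clear_value w
    obtain ⟨x, rfl⟩ := Nat.exists_eq_add_of_le hu
    obtain ⟨y, rfl⟩ := Nat.exists_eq_add_of_le hwt
    have g1 : min (u + x + t) (u + x + t + y - (u + x + t)) ≤ u + x + t := min_le_left _ _
    have g2 : min (u + x + t) (u + x + t + y - (u + x + t)) ≤ y := by omega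
    have g3 : min (u + x - u) (u + x + t + y - (u + x - u)) ≤ x := by omega
    have g4 : min (u + x - u) (u + x + t + y - (u + x - u)) ≤ u + t + y := by omega
    rcases le_total (u + x) (u + x + t + y - (u + x)) with hl | hl
    · rw [min_eq_left hl]
      nlinarith [Nat.mul_le_mul_left u g1, Nat.mul_le_mul_left t g3]
    · rw [min_eq_right hl, show u + x + t + y - (u + x) = t + y by omega]
      nlinarith [Nat.mul_le_mul_left u g2, Nat.mul_le_mul_left t g4]
  have hsum := sum_le_sum fun i (_ : i ∈ univ) => key i
  rw [sum_add_distrib, ← mul_sum, ← mul_sum, ← mul_sum] at hsum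
  have b0 := Nat.mul_le_mul_left u (ha i₀)
  have b1 := Nat.mul_le_mul_left t (ha i₁)
  refine Nat.le_of_mul_le_mul_left ?_ htu
  nlinarith

lemma sum_range_shift_of_periodic {M : Type*} [AddCommGroup M] {g : ℕ → M} {n : ℕ}
    (hg : ∀ k, g (k + n) = g k) (k : ℕ) : ∑ j ∈ range n, g (k + j) = ∑ j ∈ range n, g j := by
  induction k with
  | zero => simp
  | succ k ih =>
    rw [← ih]
    have h1 := sum_range_succ' (fun j => g (k + j)) n
    rw [sum_range_succ, hg, add_zero, add_left_inj] at h1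
    rw [h1]
    exact sum_congr rfl fun j _ => by rw [add_right_comm, add_assoc]

lemma sum_range_odd_split {M : Type*} [AddCommMonoid M] (g : ℕ → M) (n : ℕ) :
    ∑ j ∈ range (2 * n + 1), g j =
      ∑ l ∈ range (n + 1), g (2 * l) + ∑ l ∈ range n, g (2 * l + 1) := by
  induction n with
  | zero => simp
  | succ n ih =>
    rw [show 2 * (n + 1) + 1 = 2 * n + 1 + 1 + 1 by ring, sum_range_succ, sum_range_succ, ih,
      sum_range_succ _ (n + 1), sum_range_succ (fun l => g (2 * l + 1)) n,
      show 2 * (n + 1) = 2 * n + 1 + 1 by ring]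
    abel

/-- Fewer points than places on the circle. -/
lemma exists_le_sum_leeWeight' (h s : ℕ) (hlt : 2 * s + 1 < 2 * h + 1) :
    ∃ a : Fin (2 * s + 1) → ZMod (2 * h + 1), ∀ c,
      (2 * h + 1) * (s * (s + 1)) / (2 * s + 1) ≤ ∑ i, leeWeight (a i - c) := by
  obtain ⟨E, hE1, hE2, hE3⟩ := exists_almost_constant s (2 * h + 1) ⟨h, rfl⟩ hlt
  set ε : ℕ → ℤ := fun k => E (k : ZMod (2 * s + 1)) with hε
  have hεper : ∀ k, ε (k + (2 * s + 1)) = ε k := by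
    intro k
    simp only [hε]
    rw [Nat.cast_add k, ZMod.natCast_self, add_zero]
  have hε0 : ∑ j ∈ range (2 * s + 1), ε j = (2 * h + 1) * (s * (s + 1)) := by
    have : (∑ k : ZMod (2 * s + 1), (E k : ℤ)) = (2 * h + 1) * (s * (s + 1)) := by
      exact_mod_cast hE3
    rw [← this, ← Fin.sum_univ_eq_sum_range]
    refine sum_congr rfl fun k _ => ?_
    simp only [hε]
    rw [show ((k : ℕ) : ZMod (2 * s + 1)) = k from Fin.cast_val_eq_self k]
  have hεsum : ∀ k, ∑ j ∈ range (2 * s + 1), ε (k + j) = (2 * h + 1) * (s * (s + 1)) :=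
    fun k => (sum_range_shift_of_periodic hεper k).trans hε0
  -- The steps between successive points, each at most `h`. The `2s+1` steps wind `s` times around
  -- the circle (`hbper`), and they are chosen so that the distance sum from the `k`-th point is `ε
  -- k`.
  set D : ℕ → ℤ := fun k => ε k + ε (k + 1) - (2 * h + 1) * s with hD
  have hDle : ∀ k, D k ≤ h := by
    intro k
    have := hE2 k
    have h2 : 2 * (ε k + ε (k + 1)) ≤ (2 * s + 1) * (2 * h + 1) := by
      simp only [hε]; push_cast; exact_mod_cast this
    simp only [hD]
    nlinarith
  set b : ℕ → ℤ := fun k => ∑ j ∈ range k, D j with hb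
  have hbsucc : ∀ k, b (k + 1) = b k + D k := fun k => sum_range_succ _ _
  have hDper : ∀ k, D (k + (2 * s + 1)) = D k := by
    intro k
    simp only [hD, hεper, add_right_comm k (2 * s + 1) 1]
  have hbper : ∀ k, b (k + (2 * s + 1)) = b k + (2 * h + 1) * s := by
    intro k
    have : b (k + (2 * s + 1)) = b k + ∑ j ∈ range (2 * s + 1), D (k + j) := sum_range_add _ _ _
    rw [this, sum_range_shift_of_periodic hDper k]
    have h1 := hεsum 1
    simp only [add_comm 1] at h1
    simp only [hD, sum_sub_distrib, sum_add_distrib, hε0, h1, sum_const, card_range, nsmul_eq_mul]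
    push_cast
    ring
  have hcast : ((2 * h + 1 : ℤ) : ZMod (2 * h + 1)) = 0 := by
    exact_mod_cast ZMod.natCast_self (2 * h + 1)
  set β : ℕ → ZMod (2 * h + 1) := fun k => (b k : ZMod (2 * h + 1)) with hβ
  have hβper : ∀ k, β (k + (2 * s + 1)) = β k := by
    intro k
    simp only [hβ, hbper]
    rw [Int.cast_add, Int.cast_mul, hcast, zero_mul, add_zero]
  refine ⟨fun i => β i, le_sum_leeWeight_of_forall _ fun j => ?_⟩
  generalize (j : ℕ) = k
  -- Two steps fall short of a full turn, so even-indexed points lag behind the start by an amount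
  -- growing from `0` to `D (k + 2 * s) ≤ h`. In `hodd` the lead shrinks from `D k ≤ h` towards `0`.
  have heven : ∀ l ≤ s, (leeWeight (β (k + 2 * l) - β k) : ℤ) =
      l * (2 * h + 1) - (b (k + 2 * l) - b k) := by
    set G : ℕ → ℤ := fun l => l * (2 * h + 1) - (b (k + 2 * l) - b k) with hG
    have hmono : Monotone G := by
      refine monotone_nat_of_le_succ fun l => ?_
      have h1 := hDle (k + 2 * l)
      have h2 := hDle (k + 2 * l + 1)
      simp only [hG]
      rw [show k + 2 * (l + 1) = k + 2 * l + 1 + 1 by ring, hbsucc, hbsucc]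
      push_cast
      linarith
    intro l hl
    have g0 : 0 ≤ G l := by simpa [hG] using hmono (Nat.zero_le l)
    have g1 : G l ≤ h := by
      refine (hmono hl).trans ?_
      have h1 := hDle (k + 2 * s)
      have h2 := hbper k
      rw [← add_assoc, hbsucc] at h2
      simp only [hG]
      linarith
    rw [← neg_sub, leeWeight_neg]
    refine leeWeight_eq_of_intCast ?_ g0 (by push_cast; linarith)
    simp only [hβ]
    rw [Int.cast_sub, Int.cast_mul, hcast]
    push_cast
    ring
  have hodd : ∀ l < s, (leeWeight (β (k + (2 * l + 1)) - β k) : ℤ) =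
      b (k + (2 * l + 1)) - b k - l * (2 * h + 1) := by
    set G : ℕ → ℤ := fun l => b (k + (2 * l + 1)) - b k - l * (2 * h + 1) with hG
    have hanti : Antitone G := by
      refine antitone_nat_of_succ_le fun l => ?_
      have h1 := hDle (k + (2 * l + 1))
      have h2 := hDle (k + (2 * l + 1) + 1)
      simp only [hG]
      rw [show k + (2 * (l + 1) + 1) = k + (2 * l + 1) + 1 + 1 by ring, hbsucc, hbsucc]
      push_cast
      linarith
    intro l hl
    have g0 : 0 ≤ G l := by
      refine le_trans ?_ (hanti hl.le)
      simp only [hG, hbper]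
      linarith
    have g1 : G l ≤ h := by
      refine (hanti (Nat.zero_le l)).trans ?_
      have h1 := hDle k
      simp only [hG, mul_zero, zero_add, hbsucc]
      push_cast
      linarith
    refine leeWeight_eq_of_intCast ?_ g0 (by push_cast; linarith)
    simp only [hβ]
    rw [Int.cast_sub, Int.cast_mul, hcast]
    push_cast
    ring
  have hpair : ∀ n, ∑ l ∈ range n, (ε (k + 2 * l) + ε (k + 2 * l + 1)) =
      ∑ j ∈ range (2 * n), ε (k + j) := by
    intro n
    induction n with
    | zero => simp
    | succ n ih =>
      rw [sum_range_succ, ih, show 2 * (n + 1) = 2 * n + 1 + 1 by ring, sum_range_succ,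
        sum_range_succ]
      simp only [add_assoc]
  have htotal : ((∑ i : Fin (2 * s + 1), leeWeight (β i - β k) : ℕ) : ℤ) = ε k := by
    push_cast
    rw [Fin.sum_univ_eq_sum_range (fun i => (leeWeight (β i - β k) : ℤ)),
      ← sum_range_shift_of_periodic (g := fun i => (leeWeight (β i - β k) : ℤ))
        (fun i => by simp only [hβper]) k, sum_range_odd_split, sum_range_succ,
      sum_congr rfl fun l hl => heven l (mem_range.mp hl).le,
      sum_congr rfl fun l hl => hodd l (mem_range.mp hl), heven s le_rfl, add_right_comm,
      ← sum_add_distrib]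
    -- The distances at indices `2l` and `2l+1` add up to one step. The steps `D (k + 2 * l)`, `l ≤
    -- s`, cover one full period of `ε` and `ε k` once more.
    have h1 : ∀ l : ℕ, (l * (2 * h + 1) - (b (k + 2 * l) - b k) +
        (b (k + (2 * l + 1)) - b k - l * (2 * h + 1)) : ℤ) = D (k + 2 * l) := by
      intro l
      rw [← add_assoc k, hbsucc]
      ring
    have h2 : (s * (2 * h + 1) - (b (k + 2 * s) - b k) : ℤ) = D (k + 2 * s) := by
      have := hbper k
      rw [← add_assoc, hbsucc] at this
      linarith
    rw [sum_congr rfl fun l _ => h1 l, h2, ← sum_range_succ (fun l => D (k + 2 * l))]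
    simp only [hD, sum_sub_distrib]
    rw [hpair, show 2 * (s + 1) = 2 * s + 1 + 1 by ring, sum_range_succ, hεsum, hεper]
    simp
    ring
  have h3 := hE1 k
  have h4 : ε k = (E (k : ZMod (2 * s + 1)) : ℤ) := rfl
  rw [h4] at htotal
  rw [Nat.cast_inj.mp htotal]
  exact h3

/-! ### From sums of powers to Lee weights. -/

lemma leeWeight_add_le {n : ℕ} [NeZero n] (x y : ZMod n) :
    leeWeight (x + y) ≤ leeWeight x + leeWeight y :=
  (ZMod.natAbs_valMinAbs_add_le x y).trans (Int.natAbs_add_le _ _)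

namespace IsSumOfPowers

variable {F : Type*} [Field F] {k m n : ℕ} {a b : F}

lemma zero_of_pos (hk : 0 < k) (n : ℕ) : IsSumOfPowers k n (0 : F) :=
  ⟨fun _ => 0, by simp [hk.ne']⟩

lemma nsmul_pow (k n : ℕ) (y : F) : IsSumOfPowers k n (n • y ^ k) :=
  ⟨fun _ => y, by simp⟩

lemma add (ha : IsSumOfPowers k m a) (hb : IsSumOfPowers k n b) :
    IsSumOfPowers k (m + n) (a + b) := by
  obtain ⟨x, rfl⟩ := ha
  obtain ⟨y, rfl⟩ := hb
  exact ⟨Fin.append x y, by simp [Fin.sum_univ_add]⟩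

lemma mono (hk : 0 < k) (ha : IsSumOfPowers k m a) (hmn : m ≤ n) : IsSumOfPowers k n a := by
  obtain ⟨d, rfl⟩ := Nat.exists_eq_add_of_le hmn
  simpa using ha.add (zero_of_pos hk d)

lemma sum {ι : Type*} (hk : 0 < k) (s : Finset ι) {f : ι → F} {N : ι → ℕ}
    (h : ∀ i ∈ s, IsSumOfPowers k (N i) (f i)) :
    IsSumOfPowers k (∑ i ∈ s, N i) (∑ i ∈ s, f i) := by
  classical
  induction s using Finset.induction_on with
  | empty => simpa using zero_of_pos hk 0
  | insert i s hi ih =>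
    rw [sum_insert hi, sum_insert hi]
    exact (h i (mem_insert_self i s)).add (ih fun j hj => h j (mem_insert_of_mem hj))

end IsSumOfPowers

lemma waringNumber_eq_of_forall_of_exists {F : Type*} [Field F] {k V : ℕ}
    (h1 : ∀ a : F, IsSumOfPowers k V a)
    (h2 : ∃ a : F, ∀ m, IsSumOfPowers k m a → V ≤ m) : waringNumber k F = V := by
  obtain ⟨a, ha⟩ := h2
  refine le_antisymm (iSup_le fun x => iInf₂_le V (h1 x)) ?_
  exact le_trans (le_iInf₂ fun m hm => by exact_mod_cast ha m hm)
    (le_iSup (fun x : F => powerLength k x) a)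

/-- If the nonzero `k`-th powers are the `± ζ i`, lengths are given by Lee weights of coordinate
vectors with respect to `ζ`. -/
lemma isSumOfPowers_iff_exists_leeWeight {F ι : Type*} [Field F] [Fintype ι] {p k : ℕ} [NeZero p]
    [Module (ZMod p) F] (hk : 0 < k) (ζ : ι → F)
    (hζ : ∀ x : F, (∃ y, y ^ k = x) ↔ x = 0 ∨ ∃ i, x = ζ i ∨ x = -ζ i) (m : ℕ) (a : F) :
    IsSumOfPowers k m a ↔
      ∃ c : ι → ZMod p, a = ∑ i, c i • ζ i ∧ ∑ i, leeWeight (c i) ≤ m := by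
  classical
  constructor
  · induction m generalizing a with
    | zero =>
      rintro ⟨x, rfl⟩
      exact ⟨0, by simp, by simp [leeWeight]⟩
    | succ m ih =>
      rintro ⟨x, rfl⟩
      rw [Fin.sum_univ_castSucc]
      obtain ⟨c, hc, hcm⟩ := ih _ ⟨fun i => x i.castSucc, rfl⟩
      rw [hc]
      -- One more summand `±ζ i` changes a single coordinate by `±1`.
      have key : ∀ (i : ι) (e : ZMod p), leeWeight e ≤ 1 → ∃ c' : ι → ZMod p,
          ∑ i, c i • ζ i + e • ζ i = ∑ i, c' i • ζ i ∧ ∑ i, leeWeight (c' i) ≤ m + 1 := by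
        intro i e he
        refine ⟨c + Pi.single i e, ?_, ?_⟩
        · simp [add_smul, sum_add_distrib, Pi.single_apply, ite_smul]
        · calc ∑ j, leeWeight ((c + Pi.single i e : ι → ZMod p) j)
              ≤ ∑ j, (leeWeight (c j) + if j = i then leeWeight e else 0) := by
                refine sum_le_sum fun j _ => (leeWeight_add_le _ _).trans ?_
                rw [Pi.single_apply]
                split_ifs <;> simp [leeWeight]
            _ ≤ m + 1 := by
                rw [sum_add_distrib, sum_ite_eq' univ i]
                simp only [mem_univ, if_true]
                omega
      have hone : leeWeight (1 : ZMod p) ≤ 1 := by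
        have := leeWeight_natCast (n := p) (a := 1) (NeZero.one_le)
        rw [Nat.cast_one] at this
        omega
      rcases (hζ (x (Fin.last m) ^ k)).mp ⟨_, rfl⟩ with h0 | ⟨i, h1 | h1⟩
      · exact ⟨c, by rw [h0, add_zero], by omega⟩
      · obtain ⟨c', h⟩ := key i 1 hone
        exact ⟨c', by simpa [h1] using h⟩
      · obtain ⟨c', h⟩ := key i (-1) (by rwa [leeWeight_neg])
        exact ⟨c', by simpa [h1] using h⟩
  · rintro ⟨c, rfl, hc⟩
    refine IsSumOfPowers.mono hk (IsSumOfPowers.sum hk univ fun i _ => ?_) hc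
    obtain ⟨y, hy⟩ := (hζ (ζ i)).mpr (Or.inr ⟨i, Or.inl rfl⟩)
    obtain ⟨z, hz⟩ := (hζ (-ζ i)).mpr (Or.inr ⟨i, Or.inr rfl⟩)
    -- The sign of the least representative decides between copies of `ζ i` and of `-ζ i`.
    have hci : c i • ζ i = (c i).valMinAbs • ζ i := by
      conv_lhs => rw [← ZMod.coe_valMinAbs (c i)]
      rw [Int.cast_smul_eq_zsmul]
    rw [hci]
    rcases Int.natAbs_eq (c i).valMinAbs with h | h
    · rw [h, natCast_zsmul, ← hy]
      exact IsSumOfPowers.nsmul_pow _ _ _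
    · rw [h, neg_smul, natCast_zsmul, ← smul_neg, ← hz]
      exact IsSumOfPowers.nsmul_pow _ _ _

/-! ### Structure of the field. -/

lemma exists_isPrimitiveRoot_pow_eq_iff {F : Type*} [Field F] [Finite F] {k r : ℕ}
    (hr : Odd r) (hcard : Nat.card F - 1 = 2 * r * k) (hk : 0 < k) :
    ∃ ζ : F, IsPrimitiveRoot ζ r ∧ ∀ x : F, (∃ y, y ^ k = x) ↔
      x = 0 ∨ ∃ i : Fin r, x = ζ ^ (i : ℕ) ∨ x = -ζ ^ (i : ℕ) := by
  have hr0 : 0 < r := hr.pos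
  obtain ⟨g, hg⟩ := IsCyclic.exists_generator (α := Fˣ)
  have hord : orderOf g = k * (2 * r) := by
    rw [orderOf_eq_card_of_forall_mem_zpowers hg, Nat.card_units, hcard, mul_comm]
  have hprim : IsPrimitiveRoot (g : F) (k * (2 * r)) := by
    rw [IsPrimitiveRoot.coe_units_iff, ← hord]
    exact IsPrimitiveRoot.orderOf g
  have hη : IsPrimitiveRoot ((g : F) ^ k) (2 * r) := hprim.pow (by positivity) rfl
  set η := (g : F) ^ k with hηdef
  have hζ : IsPrimitiveRoot (η ^ 2) r := hη.pow (by positivity) rfl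
  have hneg : η ^ r = -1 := by
    have h1 : IsPrimitiveRoot (η ^ r) 2 := hη.pow (by positivity) (mul_comm _ _)
    exact h1.eq_neg_one_of_two_right
  refine ⟨η ^ 2, hζ, fun x => ⟨?_, ?_⟩⟩
  · rintro ⟨y, rfl⟩
    rcases eq_or_ne y 0 with rfl | hy
    · exact Or.inl (zero_pow hk.ne')
    right
    obtain ⟨j, hj⟩ : ∃ j : ℕ, g ^ j = Units.mk0 y hy :=
      (mem_powers_iff_mem_zpowers.mpr (hg _))
    have hyj : y ^ k = η ^ j := by
      rw [hηdef, pow_right_comm, ← Units.val_pow_eq_pow_val, hj, Units.val_mk0]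
    have hmod : ∀ l, (η ^ 2) ^ (l % r) = (η ^ 2) ^ l := fun l => by
      conv_rhs => rw [← Nat.mod_add_div l r, pow_add, pow_mul _ r, hζ.pow_eq_one, one_pow, mul_one]
    rcases Nat.even_or_odd' j with ⟨l, rfl | rfl⟩
    · refine ⟨⟨l % r, Nat.mod_lt _ hr0⟩, Or.inl ?_⟩
      rw [hmod, hyj, pow_mul]
    -- Since `η ^ r = -1` with `r = 2s+1`, an odd power `η ^ (2l+1)` equals `-(η ^ 2) ^ (l+s+1)`.
    · obtain ⟨s, hs⟩ := hr
      refine ⟨⟨(l + s + 1) % r, Nat.mod_lt _ hr0⟩, Or.inr ?_⟩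
      rw [hmod, hyj, ← pow_mul η, show 2 * (l + s + 1) = (2 * l + 1) + r by omega, pow_add _ _ r, hneg]
      ring
  · rintro (rfl | ⟨i, rfl | rfl⟩)
    · exact ⟨0, zero_pow hk.ne'⟩
    · exact ⟨(g : F) ^ (2 * (i : ℕ)), by rw [pow_right_comm, ← hηdef, pow_mul]⟩
    · exact ⟨(g : F) ^ (2 * (i : ℕ) + r), by
        rw [pow_right_comm, ← hηdef, pow_add, hneg, pow_mul, mul_neg_one]⟩

/-- The first `n` powers of `ζ` form a basis, and the vanishing sum of all `n + 1` powers spans the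
relations. -/
lemma exists_repr_and_forall_eq {K F : Type*} [Field K] [Field F] [Algebra K F]
    [FiniteDimensional K F] {n : ℕ} (hn : 0 < n) {ζ : F} (hζ : IsPrimitiveRoot ζ (n + 1))
    (hdeg : (minpoly K ζ).natDegree = n) (hrank : Module.finrank K F = n) :
    (∀ x : F, ∃ c : Fin (n + 1) → K, x = ∑ i, c i • ζ ^ (i : ℕ)) ∧
    (∀ c : Fin (n + 1) → K, ∑ i, c i • ζ ^ (i : ℕ) = 0 → ∀ i, c i = c (Fin.last n)) := by
  have hli : LinearIndependent K (fun i : Fin n => ζ ^ (i : ℕ)) := by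
    have := linearIndependent_pow (K := K) ζ
    rwa [hdeg] at this
  have hsum : ∑ i : Fin (n + 1), ζ ^ (i : ℕ) = 0 := by
    rw [Fin.sum_univ_eq_sum_range (fun i => ζ ^ i)]
    exact hζ.geom_sum_eq_zero (by omega)
  constructor
  · intro x
    have hspan := hli.span_eq_top_of_card_eq_finrank' (by simp [hrank])
    have hx : x ∈ Submodule.span K (Set.range fun i : Fin n => ζ ^ (i : ℕ)) := by simp [hspan]
    obtain ⟨c, hc⟩ := (Submodule.mem_span_range_iff_exists_fun K).mp hx
    exact ⟨Fin.snoc c 0, by simp [Fin.sum_univ_castSucc, hc]⟩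
  · intro c hc i
    have h1 : ∑ i : Fin (n + 1), (c i - c (Fin.last n)) • ζ ^ (i : ℕ) = 0 := by
      simp only [sub_smul, sum_sub_distrib, hc, ← smul_sum, hsum, smul_zero, sub_zero]
    rw [Fin.sum_univ_castSucc, sub_self, zero_smul, add_zero] at h1
    have h2 := Fintype.linearIndependent_iff.mp hli _ h1
    refine Fin.lastCases rfl (fun j => sub_eq_zero.mp (h2 j)) i

/-- Irreducible factors of the `r`-th cyclotomic polynomial over `ZMod p` all have degree the order
of `p` mod `r`. -/
lemma natDegree_minpoly_of_isPrimitiveRoot {F : Type*} [Field F] {p r : ℕ} [Fact p.Prime]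
    [Algebra (ZMod p) F] [FiniteDimensional (ZMod p) F] (hpr : p.Coprime r) {ζ : F}
    (hr : 0 < r) (hζ : IsPrimitiveRoot ζ r) :
    (minpoly (ZMod p) ζ).natDegree = orderOf (p : ZMod r) := by
  have hint : IsIntegral (ZMod p) ζ := Algebra.IsIntegral.isIntegral ζ
  have hdvd : minpoly (ZMod p) ζ ∣ Polynomial.cyclotomic r (ZMod p) := by
    refine minpoly.dvd _ _ ?_
    rw [← Polynomial.eval_map_algebraMap, Polynomial.map_cyclotomic]
    exact hζ.isRoot_cyclotomic hr
  rw [Polynomial.natDegree_of_dvd_cyclotomic_of_irreducible (f := 1) (p := p) (by simp) hpr hdvd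
    (minpoly.irreducible hint), ← orderOf_units]
  simp

/-! ### The Waring number. -/

lemma floor_sub_eq (m s : ℕ) :
    ⌊(m * (2 * s + 1 : ℕ) : ℚ) / 4 - (m : ℚ) / (4 * (2 * s + 1 : ℕ))⌋₊ =
      m * (s * (s + 1)) / (2 * s + 1) := by
  rw [← Nat.floor_div_eq_div (K := ℚ)]
  congr 1
  have : (2 * s + 1 : ℚ) ≠ 0 := by positivity
  push_cast
  field_simp
  ring

theorem theorem2 (p r : ℕ) (hp : p.Prime) (hr : r.Prime) (hp_odd : Odd p) (hr_odd : Odd r)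
    (hprim : orderOf (p : ZMod r) = r - 1)
    (F : Type*) [Field F] (hF : Nat.card F = p ^ (r - 1)) :
    waringNumber ((p ^ (r - 1) - 1) / (2 * r)) F =
      ((if r < p then ⌊(p * r : ℚ) / 4 - (p : ℚ) / (4 * r)⌋₊
        else ⌊(p * r : ℚ) / 4 - (r : ℚ) / (4 * p)⌋₊ : ℕ) : ℕ∞) := by
  have : Fact p.Prime := ⟨hp⟩
  have hr1 : 0 < r - 1 := by have := hr.two_le; omega
  have hpow1 : (p : ZMod r) ^ (r - 1) = 1 := hprim ▸ pow_orderOf_eq_one _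
  have hne : p ≠ r := by
    rintro rfl
    have : Fact (1 < p) := ⟨hp.one_lt⟩
    rw [ZMod.natCast_self, zero_pow hr1.ne'] at hpow1
    exact zero_ne_one hpow1
  have hcop : p.Coprime r := (Nat.coprime_primes hp hr).mpr hne
  have hdvd : 2 * r ∣ p ^ (r - 1) - 1 := by
    refine Nat.Coprime.mul_dvd_of_dvd_of_dvd (Nat.coprime_two_left.mpr hr_odd) ?_ ?_
    · exact (Nat.Odd.sub_odd hp_odd.pow odd_one).two_dvd
    · rw [← ZMod.natCast_eq_zero_iff, Nat.cast_sub (Nat.one_le_pow _ _ hp.pos)]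
      simp [hpow1]
  obtain ⟨k, hk⟩ := hdvd
  have hkpos : 0 < k := by
    have h1 : 1 < p ^ (r - 1) := Nat.one_lt_pow hr1.ne' hp.one_lt
    rcases Nat.eq_zero_or_pos k with rfl | h
    · omega
    · exact h
  have hfin : Finite F := Nat.finite_of_card_ne_zero (by rw [hF]; exact pow_ne_zero _ hp.ne_zero)
  have := Fintype.ofFinite F
  have hchar : CharP F p := charP_of_card_eq_prime_pow (by rw [← Nat.card_eq_fintype_card, hF])
  let _ : Algebra (ZMod p) F := ZMod.algebra F p
  have hrank : Module.finrank (ZMod p) F = r - 1 := by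
    have h1 := Module.natCard_eq_pow_finrank (K := ZMod p) (V := F)
    rw [hF, Nat.card_zmod] at h1
    exact (Nat.pow_right_injective hp.two_le h1).symm
  obtain ⟨ζ, hζ, hpow⟩ := exists_isPrimitiveRoot_pow_eq_iff hr_odd (hF ▸ hk) hkpos
  have hdeg := (natDegree_minpoly_of_isPrimitiveRoot hcop hr.pos hζ).trans hprim
  rw [hk, Nat.mul_div_cancel_left _ (by have := hr.pos; positivity)]
  obtain ⟨s, rfl⟩ := hr_odd
  obtain ⟨h, rfl⟩ := hp_odd
  rw [Nat.add_sub_cancel] at hr1 hdeg hrank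
  obtain ⟨hrepr, hker⟩ := exists_repr_and_forall_eq hr1 hζ hdeg hrank
  have hiff := isSumOfPowers_iff_exists_leeWeight (p := 2 * h + 1) hkpos
    (fun i : Fin (2 * s + 1) => ζ ^ (i : ℕ)) hpow
  have hgeom : ∑ i : Fin (2 * s + 1), ζ ^ (i : ℕ) = 0 := by
    rw [Fin.sum_univ_eq_sum_range (fun i => ζ ^ i)]
    exact hζ.geom_sum_eq_zero (by omega)
  -- Coefficient vectors of an element are unique up to a common shift `c`, so the problem becomes
  -- the one about points on a circle.
  have hreduce : ∀ V : ℕ,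
      (∀ a : Fin (2 * s + 1) → ZMod (2 * h + 1), ∃ c, ∑ i, leeWeight (a i - c) ≤ V) →
      (∃ a : Fin (2 * s + 1) → ZMod (2 * h + 1), ∀ c, V ≤ ∑ i, leeWeight (a i - c)) →
      waringNumber k F = V := by
    intro V hup hlow
    refine waringNumber_eq_of_forall_of_exists (fun x => ?_) ?_
    · obtain ⟨a, rfl⟩ := hrepr x
      obtain ⟨c, hc⟩ := hup a
      refine (hiff _ _).mpr ⟨fun i => a i - c, ?_, hc⟩
      simp only [sub_smul, sum_sub_distrib, ← smul_sum, hgeom, smul_zero, sub_zero]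
    · obtain ⟨a, ha⟩ := hlow
      refine ⟨∑ i, a i • ζ ^ (i : ℕ), fun m hm => ?_⟩
      obtain ⟨b, hb, hbm⟩ := (hiff _ _).mp hm
      have hconst := hker (fun i => a i - b i) (by
        simp only [sub_smul, sum_sub_distrib]
        exact sub_eq_zero.mpr hb)
      refine (ha (a (Fin.last _) - b (Fin.last _))).trans (le_trans (le_of_eq ?_) hbm)
      refine sum_congr rfl fun i _ => ?_
      rw [← hconst i, sub_sub_cancel]
  split_ifs with hlt
  · rw [floor_sub_eq]
    exact hreduce _ (exists_sum_leeWeight_le' h s (Fintype.card_fin _))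
      (exists_le_sum_leeWeight' h s hlt)
  · rw [mul_comm ((2 * h + 1 : ℕ) : ℚ), floor_sub_eq]
    refine hreduce _ (fun a => ?_) ?_
    · simpa only [Fintype.card_fin] using exists_sum_leeWeight_le h a
    · have := exists_le_sum_leeWeight (ι := Fin (2 * s + 1)) h
        (by rw [Fintype.card_fin]; exact ⟨s, rfl⟩) (by rw [Fintype.card_fin]; omega)
      simpa only [Fintype.card_fin] using this
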